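/- Let $n\ge 1$ and let $U=\boldsymbol U_v(\mathfrak q_n)$ be the quantum queer superalgebra: the associative unital $\mathbb Q(v)$-superalgebra with even generators $K_i, K_i^{-1}$ $(1\le i\le n)$, $E_j, F_j$ $(1\le j\le n-1)$ and odd generators $K_{\bar i}$ $(1\le i\le n)$, $E_{\bar j}, F_{\bar j}$ $(1\le j\le n-1)$, subject to the following relations, where $(\epsilon_i,\alpha_j)=\delta_{i,j}-\delta_{i,j+1}$ and indices run over all values for which the symbols are defined. (QQ1) $K_iK_i^{-1}=K_i^{-1}K_i=1$, $K_iK_j=K_jK_i$, $K_iK_{\bar j}=K_{\bar j}K_i$, $K_{\bar i}K_{\bar j}+K_{\bar j}K_{\bar i}=2\delta_{i,j}\dfrac{K_i^2-K_i^{-2}}{v^2-v^{-2}}$. (QQ2) $K_iE_j=v^{(\epsilon_i,\alpha_j)}E_jK_i$, $K_iE_{\bar j}=v^{(\epsilon_i,\alpha_j)}E_{\bar j}K_i$, $K_iF_j=v^{-(\epsilon_i,\alpha_j)}F_jK_i$, $K_iF_{\bar j}=v^{-(\epsilon_i,\alpha_j)}F_{\bar j}K_i$. (QQ3) $K_{\bar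 i}E_i-vE_iK_{\bar i}=E_{\bar i}K_i^{-1}$, $vK_{\bar i}E_{i-1}-E_{i-1}K_{\bar i}=-K_i^{-1}E_{\overline{i-1}}$, $K_{\bar i}F_i-vF_iK_{\bar i}=-F_{\bar i}K_i$, $vK_{\bar i}F_{i-1}-F_{i-1}K_{\bar i}=K_iF_{\overline{i-1}}$, $K_{\bar i}E_{\bar i}+vE_{\bar i}K_{\bar i}=E_iK_i^{-1}$, $vK_{\bar i}E_{\overline{i-1}}+E_{\overline{i-1}}K_{\bar i}=K_i^{-1}E_{i-1}$, $K_{\bar i}F_{\bar i}+vF_{\bar i}K_{\bar i}=F_iK_i$, $vK_{\bar i}F_{\overline{i-1}}+F_{\overline{i-1}}K_{\bar i}=K_iF_{i-1}$, and $K_{\bar i}E_j-E_jK_{\bar i}=K_{\bar i}F_j-F_jK_{\bar i}=K_{\bar i}E_{\bar j}+E_{\bar j}K_{\bar i}=K_{\bar i}F_{\bar j}+F_{\bar j}K_{\bar i}=0$ for $j\ne i,i-1$. (QQ4) $E_iF_j-F_jE_i=\delta_{i,j}\dfrac{K_iK_{i+1}^{-1}-K_i^{-1}K_{i+1}}{v-v^{-1}}$,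 $E_{\bar i}F_{\bar j}+F_{\bar j}E_{\bar i}=\delta_{i,j}\Big(\dfrac{K_iK_{i+1}-K_i^{-1}K_{i+1}^{-1}}{v-v^{-1}}+(v-v^{-1})K_{\bar i}K_{\overline{i+1}}\Big)$, $E_iF_{\bar j}-F_{\bar j}E_i=\delta_{i,j}(K_{i+1}^{-1}K_{\bar i}-K_{\overline{i+1}}K_i^{-1})$, $E_{\bar i}F_j-F_jE_{\bar i}=\delta_{i,j}(K_{i+1}K_{\bar i}-K_{\overline{i+1}}K_i)$. (QQ5) $E_{\bar i}^2=-\frac{v-v^{-1}}{v+v^{-1}}E_i^2$, $F_{\bar i}^2=\frac{v-v^{-1}}{v+v^{-1}}F_i^2$; $E_iE_{\bar j}-E_{\bar j}E_i=F_iF_{\bar j}-F_{\bar j}F_i=0$ for $|i-j|\ne1$; $E_iE_j-E_jE_i=F_iF_j-F_jF_i=E_{\bar i}E_{\bar j}+E_{\bar j}E_{\bar i}=F_{\bar i}F_{\bar j}+F_{\bar j}F_{\bar i}=0$ for $|i-j|>1$; $E_iE_{i+1}-vE_{i+1}E_i=E_{\bar i}E_{\overline{i+1}}+vE_{\overline{i+1}}E_{\bar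 i}$, $E_iE_{\overline{i+1}}-vE_{\overline{i+1}}E_i=E_{\bar i}E_{i+1}-vE_{i+1}E_{\bar i}$, $F_iF_{i+1}-vF_{i+1}F_i=-(F_{\bar i}F_{\overline{i+1}}+vF_{\overline{i+1}}F_{\bar i})$, $F_iF_{\overline{i+1}}-vF_{\overline{i+1}}F_i=F_{\bar i}F_{i+1}-vF_{i+1}F_{\bar i}$. (QQ6) For $|i-j|=1$: $X_i^2Y-(v+v^{-1})X_iYX_i+YX_i^2=0$ for $(X_i,Y)$ equal to $(E_i,E_j)$, $(E_i,E_{\bar j})$, $(F_i,F_j)$, $(F_i,F_{\bar j})$. The quantum root vectors of $U$ are defined as follows. For $1\le i<n$ put $E_{i,i+1}=E_i$, $\overline E_{i,i+1}=E_{\bar i}$, $E_{i+1,i}=F_i$, $\overline E_{i+1,i}=F_{\bar i}$, and for $1\le i$, $i+1<j\le n$, recursively, $$E_{i,j}=-E_{i,j-1}E_{j-1}+v^{-1}E_{j-1}E_{i,j-1},\qquad \overline E_{i,j}=-E_{i,j-1}E_{\overline{j-1}}+v^{-1}E_{\overline{j-1}}E_{i,j-1},$$ $$E_{j,i}=-F_{j-1}E_{j-1,i}+vE_{j-1,i}F_{j-1},\qquad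 \overline E_{j,i}=-F_{\overline{j-1}}E_{j-1,i}+vE_{j-1,i}F_{\overline{j-1}}.$$ **Lemma.** Let $1\le i,j,k,l\le n$ with $i<j$ and $k<l$. Then the following holds in $U$. If $i<j\le k<l$ or $i<k<l<j$ or $k<l\le i<j$ or $k<i<j<l$, then $E_{j,i}\overline E_{k,l}=\overline E_{k,l}E_{j,i}$. In the remaining cases $E_{j,i}\overline E_{k,l}$ equals 1. $\overline E_{k,l}E_{j,i}-\overline E_{j,l}K_jK_i^{-1}$, if $i=k<j<l$; 2. $\overline E_{k,l}E_{j,i}+\overline E_{j,i}E_{k,j}K_j^2-E_{k,j}\overline E_{j,i}K_j^2-(v-v^{-1})E_{k,i}K_{\bar j}K_k^{-1}K_j^2$, if $i<k<j=l$; 3. $\overline E_{k,l}E_{j,i}-(v-v^{-1})E_{k,i}\overline E_{j,l}K_jK_k^{-1}$, if $i<k<j<l$; 4. $\overline E_{k,l}E_{j,i}+(\overline E_{j,i}E_{i,j}-E_{i,j}\overline E_{j,i})K_j^2-K_{\bar j}K_i^{-1}K_j^2+K_{\bar j}K_i$, if $i=k$ and $j=l$; 5. $\overline E_{k,l}E_{j,i}+vK_{\bar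 l}E_{j,l}K_i-E_{j,l}K_{\bar l}K_i$, if $k=i<l<j$; 6. $\overline E_{k,l}E_{j,i}-(v-v^{-1})K_{\bar l}E_{j,l}E_{k,i}K_i+(1-v^{-2})E_{j,l}K_{\bar l}E_{k,i}K_i$, if $k<i<l<j$; 7. $\overline E_{k,j}E_{j,i}+\overline E_{j,i}E_{k,j}K_j^2-E_{k,j}\overline E_{j,i}K_j^2-(1-v^{-2})E_{k,i}K_iK_{\bar j}$, if $k<i<j=l$. -/

import Mathlib

noncomputable section

namespace QuantumQueer

/-- The ground field of rational functions in one variable over the rationals. -/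
abbrev Qv : Type := RatFunc ℚ

/-- The quantum parameter, that is, the indeterminate of the ground field. -/
def v : Qv := RatFunc.X

/-- The generators, with indices as in the usual (1-based) presentation:
`K i`, its inverse `Kinv i` and the odd `Kbar i` for `1 ≤ i ≤ n`;
`E j`, `F j` and the odd `Ebar j`, `Fbar j` for `1 ≤ j ≤ n - 1`. -/
inductive Gen (n : ℕ) : Type
  | K (i : ℕ) (h : 1 ≤ i ∧ i ≤ n) : Gen n
  | Kinv (i : ℕ) (h : 1 ≤ i ∧ i ≤ n) : Gen n
  | Kbar (i : ℕ) (h : 1 ≤ i ∧ i ≤ n) : Gen n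
  | E (j : ℕ) (h : 1 ≤ j ∧ j < n) : Gen n
  | F (j : ℕ) (h : 1 ≤ j ∧ j < n) : Gen n
  | Ebar (j : ℕ) (h : 1 ≤ j ∧ j < n) : Gen n
  | Fbar (j : ℕ) (h : 1 ≤ j ∧ j < n) : Gen n

/-- The free associative unital algebra on the generators. -/
abbrev Free (n : ℕ) : Type := FreeAlgebra Qv (Gen n)

namespace Free

/-! The generators as elements of the free algebra; for an index out of range, which occurs in none
of the relations, the value is `0`. -/

def K (n i : ℕ) : Free n := if h : 1 ≤ i ∧ i ≤ n then FreeAlgebra.ι Qv (Gen.K i h) else 0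
def Kinv (n i : ℕ) : Free n := if h : 1 ≤ i ∧ i ≤ n then FreeAlgebra.ι Qv (Gen.Kinv i h) else 0
def Kbar (n i : ℕ) : Free n := if h : 1 ≤ i ∧ i ≤ n then FreeAlgebra.ι Qv (Gen.Kbar i h) else 0
def E (n j : ℕ) : Free n := if h : 1 ≤ j ∧ j < n then FreeAlgebra.ι Qv (Gen.E j h) else 0
def F (n j : ℕ) : Free n := if h : 1 ≤ j ∧ j < n then FreeAlgebra.ι Qv (Gen.F j h) else 0
def Ebar (n j : ℕ) : Free n := if h : 1 ≤ j ∧ j < n then FreeAlgebra.ι Qv (Gen.Ebar j h) else 0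
def Fbar (n j : ℕ) : Free n := if h : 1 ≤ j ∧ j < n then FreeAlgebra.ι Qv (Gen.Fbar j h) else 0

end Free

/-- Kronecker delta. -/
def δ (i j : ℕ) : ℤ := if i = j then 1 else 0

/-- The pairing of the `i`-th standard weight with the `j`-th simple root `ε_j - ε_{j+1}`. -/
def pair (i j : ℕ) : ℤ := δ i j - δ i (j + 1)

open Free in
/-- The defining relations of the quantum queer superalgebra. -/
inductive Rel (n : ℕ) : Free n → Free n → Prop
  -- (QQ1), for `1 ≤ i, j ≤ n`
  | K_Kinv (i : ℕ) (hi : 1 ≤ i ∧ i ≤ n) : Rel n (K n i * Kinv n i) 1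
  | Kinv_K (i : ℕ) (hi : 1 ≤ i ∧ i ≤ n) : Rel n (Kinv n i * K n i) 1
  | K_K (i j : ℕ) (hi : 1 ≤ i ∧ i ≤ n) (hj : 1 ≤ j ∧ j ≤ n) :
      Rel n (K n i * K n j) (K n j * K n i)
  | K_Kbar (i j : ℕ) (hi : 1 ≤ i ∧ i ≤ n) (hj : 1 ≤ j ∧ j ≤ n) :
      Rel n (K n i * Kbar n j) (Kbar n j * K n i)
  | Kbar_Kbar (i j : ℕ) (hi : 1 ≤ i ∧ i ≤ n) (hj : 1 ≤ j ∧ j ≤ n) :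
      Rel n (Kbar n i * Kbar n j + Kbar n j * Kbar n i)
        ((2 * (δ i j : Qv) / (v ^ 2 - v⁻¹ ^ 2)) • (K n i ^ 2 - Kinv n i ^ 2))
  -- (QQ2), for `1 ≤ i ≤ n` and `1 ≤ j ≤ n - 1`
  | K_E (i j : ℕ) (hi : 1 ≤ i ∧ i ≤ n) (hj : 1 ≤ j ∧ j < n) :
      Rel n (K n i * E n j) (v ^ pair i j • (E n j * K n i))
  | K_Ebar (i j : ℕ) (hi : 1 ≤ i ∧ i ≤ n) (hj : 1 ≤ j ∧ j < n) :
      Rel n (K n i * Ebar n j) (v ^ pair i j • (Ebar n j * K n i))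
  | K_F (i j : ℕ) (hi : 1 ≤ i ∧ i ≤ n) (hj : 1 ≤ j ∧ j < n) :
      Rel n (K n i * F n j) (v ^ (-pair i j) • (F n j * K n i))
  | K_Fbar (i j : ℕ) (hi : 1 ≤ i ∧ i ≤ n) (hj : 1 ≤ j ∧ j < n) :
      Rel n (K n i * Fbar n j) (v ^ (-pair i j) • (Fbar n j * K n i))
  -- (QQ3); the index `i - 1` of the usual presentation is written `i`, and `i` is written `i + 1`
  | Kbar_E (i : ℕ) (hi : 1 ≤ i ∧ i < n) :
      Rel n (Kbar n i * E n i - v • (E n i * Kbar n i)) (Ebar n i * Kinv n i)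
  | Kbar_succ_E (i : ℕ) (hi : 1 ≤ i ∧ i < n) :
      Rel n (v • (Kbar n (i + 1) * E n i) - E n i * Kbar n (i + 1))
        (-(Kinv n (i + 1) * Ebar n i))
  | Kbar_F (i : ℕ) (hi : 1 ≤ i ∧ i < n) :
      Rel n (Kbar n i * F n i - v • (F n i * Kbar n i)) (-(Fbar n i * K n i))
  | Kbar_succ_F (i : ℕ) (hi : 1 ≤ i ∧ i < n) :
      Rel n (v • (Kbar n (i + 1) * F n i) - F n i * Kbar n (i + 1)) (K n (i + 1) * Fbar n i)
  | Kbar_Ebar (i : ℕ) (hi : 1 ≤ i ∧ i < n) :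
      Rel n (Kbar n i * Ebar n i + v • (Ebar n i * Kbar n i)) (E n i * Kinv n i)
  | Kbar_succ_Ebar (i : ℕ) (hi : 1 ≤ i ∧ i < n) :
      Rel n (v • (Kbar n (i + 1) * Ebar n i) + Ebar n i * Kbar n (i + 1)) (Kinv n (i + 1) * E n i)
  | Kbar_Fbar (i : ℕ) (hi : 1 ≤ i ∧ i < n) :
      Rel n (Kbar n i * Fbar n i + v • (Fbar n i * Kbar n i)) (F n i * K n i)
  | Kbar_succ_Fbar (i : ℕ) (hi : 1 ≤ i ∧ i < n) :
      Rel n (v • (Kbar n (i + 1) * Fbar n i) + Fbar n i * Kbar n (i + 1)) (K n (i + 1) * F n i)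
  | Kbar_E_far (i j : ℕ) (hi : 1 ≤ i ∧ i ≤ n) (hj : 1 ≤ j ∧ j < n) (hij : j ≠ i ∧ j + 1 ≠ i) :
      Rel n (Kbar n i * E n j - E n j * Kbar n i) 0
  | Kbar_F_far (i j : ℕ) (hi : 1 ≤ i ∧ i ≤ n) (hj : 1 ≤ j ∧ j < n) (hij : j ≠ i ∧ j + 1 ≠ i) :
      Rel n (Kbar n i * F n j - F n j * Kbar n i) 0
  | Kbar_Ebar_far (i j : ℕ) (hi : 1 ≤ i ∧ i ≤ n) (hj : 1 ≤ j ∧ j < n) (hij : j ≠ i ∧ j + 1 ≠ i) :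
      Rel n (Kbar n i * Ebar n j + Ebar n j * Kbar n i) 0
  | Kbar_Fbar_far (i j : ℕ) (hi : 1 ≤ i ∧ i ≤ n) (hj : 1 ≤ j ∧ j < n) (hij : j ≠ i ∧ j + 1 ≠ i) :
      Rel n (Kbar n i * Fbar n j + Fbar n j * Kbar n i) 0
  -- (QQ4), for `1 ≤ i, j ≤ n - 1`
  | E_F (i j : ℕ) (hi : 1 ≤ i ∧ i < n) (hj : 1 ≤ j ∧ j < n) :
      Rel n (E n i * F n j - F n j * E n i)
        (((δ i j : Qv) / (v - v⁻¹)) • (K n i * Kinv n (i + 1) - Kinv n i * K n (i + 1)))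
  | Ebar_Fbar (i j : ℕ) (hi : 1 ≤ i ∧ i < n) (hj : 1 ≤ j ∧ j < n) :
      Rel n (Ebar n i * Fbar n j + Fbar n j * Ebar n i)
        ((δ i j : Qv) • ((v - v⁻¹)⁻¹ • (K n i * K n (i + 1) - Kinv n i * Kinv n (i + 1))
          + (v - v⁻¹) • (Kbar n i * Kbar n (i + 1))))
  | E_Fbar (i j : ℕ) (hi : 1 ≤ i ∧ i < n) (hj : 1 ≤ j ∧ j < n) :
      Rel n (E n i * Fbar n j - Fbar n j * E n i)
        ((δ i j : Qv) • (Kinv n (i + 1) * Kbar n i - Kbar n (i + 1) * Kinv n i))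
  | Ebar_F (i j : ℕ) (hi : 1 ≤ i ∧ i < n) (hj : 1 ≤ j ∧ j < n) :
      Rel n (Ebar n i * F n j - F n j * Ebar n i)
        ((δ i j : Qv) • (K n (i + 1) * Kbar n i - Kbar n (i + 1) * K n i))
  -- (QQ5)
  | Ebar_sq (i : ℕ) (hi : 1 ≤ i ∧ i < n) :
      Rel n (Ebar n i ^ 2) ((-((v - v⁻¹) / (v + v⁻¹))) • E n i ^ 2)
  | Fbar_sq (i : ℕ) (hi : 1 ≤ i ∧ i < n) :
      Rel n (Fbar n i ^ 2) (((v - v⁻¹) / (v + v⁻¹)) • F n i ^ 2)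
  | E_Ebar_comm (i j : ℕ) (hi : 1 ≤ i ∧ i < n) (hj : 1 ≤ j ∧ j < n)
      (hij : i + 1 ≠ j ∧ j + 1 ≠ i) : Rel n (E n i * Ebar n j - Ebar n j * E n i) 0
  | F_Fbar_comm (i j : ℕ) (hi : 1 ≤ i ∧ i < n) (hj : 1 ≤ j ∧ j < n)
      (hij : i + 1 ≠ j ∧ j + 1 ≠ i) : Rel n (F n i * Fbar n j - Fbar n j * F n i) 0
  | E_E_far (i j : ℕ) (hi : 1 ≤ i ∧ i < n) (hj : 1 ≤ j ∧ j < n)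
      (hij : i + 1 < j ∨ j + 1 < i) : Rel n (E n i * E n j - E n j * E n i) 0
  | F_F_far (i j : ℕ) (hi : 1 ≤ i ∧ i < n) (hj : 1 ≤ j ∧ j < n)
      (hij : i + 1 < j ∨ j + 1 < i) : Rel n (F n i * F n j - F n j * F n i) 0
  | Ebar_Ebar_far (i j : ℕ) (hi : 1 ≤ i ∧ i < n) (hj : 1 ≤ j ∧ j < n)
      (hij : i + 1 < j ∨ j + 1 < i) : Rel n (Ebar n i * Ebar n j + Ebar n j * Ebar n i) 0
  | Fbar_Fbar_far (i j : ℕ) (hi : 1 ≤ i ∧ i < n) (hj : 1 ≤ j ∧ j < n)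
      (hij : i + 1 < j ∨ j + 1 < i) : Rel n (Fbar n i * Fbar n j + Fbar n j * Fbar n i) 0
  | E_E_succ (i : ℕ) (hi : 1 ≤ i ∧ i + 1 < n) :
      Rel n (E n i * E n (i + 1) - v • (E n (i + 1) * E n i))
        (Ebar n i * Ebar n (i + 1) + v • (Ebar n (i + 1) * Ebar n i))
  | E_Ebar_succ (i : ℕ) (hi : 1 ≤ i ∧ i + 1 < n) :
      Rel n (E n i * Ebar n (i + 1) - v • (Ebar n (i + 1) * E n i))
        (Ebar n i * E n (i + 1) - v • (E n (i + 1) * Ebar n i))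
  | F_F_succ (i : ℕ) (hi : 1 ≤ i ∧ i + 1 < n) :
      Rel n (F n i * F n (i + 1) - v • (F n (i + 1) * F n i))
        (-(Fbar n i * Fbar n (i + 1) + v • (Fbar n (i + 1) * Fbar n i)))
  | F_Fbar_succ (i : ℕ) (hi : 1 ≤ i ∧ i + 1 < n) :
      Rel n (F n i * Fbar n (i + 1) - v • (Fbar n (i + 1) * F n i))
        (Fbar n i * F n (i + 1) - v • (F n (i + 1) * Fbar n i))
  -- (QQ6), for `|i - j| = 1`
  | serre_E (i j : ℕ) (hi : 1 ≤ i ∧ i < n) (hj : 1 ≤ j ∧ j < n) (hij : i + 1 = j ∨ j + 1 = i) :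
      Rel n (E n i ^ 2 * E n j - (v + v⁻¹) • (E n i * E n j * E n i) + E n j * E n i ^ 2) 0
  | serre_F (i j : ℕ) (hi : 1 ≤ i ∧ i < n) (hj : 1 ≤ j ∧ j < n) (hij : i + 1 = j ∨ j + 1 = i) :
      Rel n (F n i ^ 2 * F n j - (v + v⁻¹) • (F n i * F n j * F n i) + F n j * F n i ^ 2) 0
  | serre_Ebar (i j : ℕ) (hi : 1 ≤ i ∧ i < n) (hj : 1 ≤ j ∧ j < n) (hij : i + 1 = j ∨ j + 1 = i) :
      Rel n (E n i ^ 2 * Ebar n j - (v + v⁻¹) • (E n i * Ebar n j * E n i)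
        + Ebar n j * E n i ^ 2) 0
  | serre_Fbar (i j : ℕ) (hi : 1 ≤ i ∧ i < n) (hj : 1 ≤ j ∧ j < n) (hij : i + 1 = j ∨ j + 1 = i) :
      Rel n (F n i ^ 2 * Fbar n j - (v + v⁻¹) • (F n i * Fbar n j * F n i)
        + Fbar n j * F n i ^ 2) 0

/-- The (underlying associative algebra of the) quantum queer superalgebra. -/
abbrev U (n : ℕ) : Type := RingQuot (Rel n)

/-- The quotient map from the free algebra. -/
def mk (n : ℕ) : Free n →ₐ[Qv] U n := RingQuot.mkAlgHom Qv (Rel n)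

/-! The generators as elements of the quantum queer superalgebra. -/

def K (n i : ℕ) : U n := mk n (Free.K n i)
def Kinv (n i : ℕ) : U n := mk n (Free.Kinv n i)
def Kbar (n i : ℕ) : U n := mk n (Free.Kbar n i)
def E (n j : ℕ) : U n := mk n (Free.E n j)
def F (n j : ℕ) : U n := mk n (Free.F n j)
def Ebar (n j : ℕ) : U n := mk n (Free.Ebar n j)
def Fbar (n j : ℕ) : U n := mk n (Free.Fbar n j)

/-- The even positive root vector with indices `(i, i + d + 1)`. -/
def posRoot (n i : ℕ) : ℕ → U n
  | 0 => E n i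
  | d + 1 => -(posRoot n i d * E n (i + d + 1)) + v⁻¹ • (E n (i + d + 1) * posRoot n i d)

/-- The odd positive root vector with indices `(i, i + d + 1)`. -/
def posRootBar (n i : ℕ) : ℕ → U n
  | 0 => Ebar n i
  | d + 1 => -(posRoot n i d * Ebar n (i + d + 1)) + v⁻¹ • (Ebar n (i + d + 1) * posRoot n i d)

/-- The even negative root vector with indices `(i + d + 1, i)`. -/
def negRoot (n i : ℕ) : ℕ → U n
  | 0 => F n i
  | d + 1 => -(F n (i + d + 1) * negRoot n i d) + v • (negRoot n i d * F n (i + d + 1))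

/-- The odd negative root vector with indices `(i + d + 1, i)`. -/
def negRootBar (n i : ℕ) : ℕ → U n
  | 0 => Fbar n i
  | d + 1 => -(Fbar n (i + d + 1) * negRoot n i d) + v • (negRoot n i d * Fbar n (i + d + 1))

/-- The even quantum root vector with indices `i ≠ j` (positive if `i < j`, negative if `j < i`);
the value for `i = j` is irrelevant. -/
def rootE (n i j : ℕ) : U n :=
  if i < j then posRoot n i (j - i - 1) else if j < i then negRoot n j (i - j - 1) else 0

/-- The odd quantum root vector with indices `i ≠ j` (positive if `i < j`, negative if `j < i`);
the value for `i = j` is irrelevant. -/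
def rootEbar (n i j : ℕ) : U n :=
  if i < j then posRootBar n i (j - i - 1) else if j < i then negRootBar n j (i - j - 1) else 0

end QuantumQueer

end

open QuantumQueer

set_option linter.unusedSimpArgs false
set_option linter.unnecessarySeqFocus false

namespace QuantumQueer

/-! Since E_{j,i} is even, x ↦ [E_{j,i}, x] is an ordinary derivation, with no super signs
(`commutator_bracket`). Every root vector is a skew bracket of two shorter ones, cut at any
intermediate index; for an odd one the bar sits on the upper piece (`rootE_split`, `rootEbar_split`,
`rootE_neg_split`).

If j ≠ l, cut the odd vector Ē_{k,l} at an endpoint of the other root, or split off its last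
generator. One of the two pieces then commutes with E_{j,i}, and the commutator with the other is
already known. What remains is a skew bracket of a weight vector with an expression containing
Cartan factors. Moving these factors across costs powers of v, so the bracket vanishes, becomes a
shorter ordinary commutator, or yields a scalar such as v - v⁻¹. The starting points are [F_i, E_i]
and [F_i, Ē_i].

If j = l, Ē_{k,j} and Ē_{j,i} are both skew commutators of their even counterparts with K̄_j
(`Kbar_mul_rootE`, `Kbar_mul_rootE_neg`). Substituting these, all mixed terms cancel and only the
even commutator [E_{j,i}, E_{k,j}] is left (`mixed_commutator`). It is given by `commutator_right`,
`commutator_opposite` or `commutator_lower` according as i < k, i = k or k < i. -/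

/-- The canonical algebra structure, preferred over the one inherited from polynomials because it is
the one that the normalization of scalars recognizes. -/
noncomputable instance natAlgebraQv : Algebra ℕ Qv := Semiring.toNatAlgebra

/-- The canonical algebra structure, preferred over the one inherited from polynomials because it is
the one that the normalization of scalars recognizes. -/
noncomputable instance intAlgebraQv : Algebra ℤ Qv := Ring.toIntAlgebra _

theorem v_ne_zero : v ≠ 0 := RatFunc.X_ne_zero

/-- Together with v ≠ 0 this makes v - v⁻¹ invertible, so that `field_simp` can clear the
denominator of the Cartan commutator. -/
theorem v_sq_sub_one_ne_zero : v ^ 2 - 1 ≠ 0 := by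
  have h : v ^ 2 - 1 = algebraMap (Polynomial ℚ) (RatFunc ℚ) (Polynomial.X ^ 2 - 1) := by
    simp [v]
  rw [h]
  refine RatFunc.algebraMap_ne_zero fun h0 => ?_
  simpa using congrArg (Polynomial.eval 0) h0

/-! ### The defining relations in the quotient -/

section Relations

variable {n : ℕ}

theorem mk_rel {a b : Free n} (h : Rel n a b) : mk n a = mk n b :=
  RingQuot.mkAlgHom_rel Qv h

theorem K_mul_Kinv {i : ℕ} (hi : 1 ≤ i ∧ i ≤ n) : K n i * Kinv n i = 1 := by
  simpa [K, Kinv] using mk_rel (Rel.K_Kinv i hi)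

theorem Kinv_mul_K {i : ℕ} (hi : 1 ≤ i ∧ i ≤ n) : Kinv n i * K n i = 1 := by
  simpa [K, Kinv] using mk_rel (Rel.Kinv_K i hi)

theorem commute_K_K {i j : ℕ} (hi : 1 ≤ i ∧ i ≤ n) (hj : 1 ≤ j ∧ j ≤ n) :
    Commute (K n i) (K n j) := by
  simpa [commute_iff_eq, K] using mk_rel (Rel.K_K i j hi hj)

theorem commute_K_Kbar {i j : ℕ} (hi : 1 ≤ i ∧ i ≤ n) (hj : 1 ≤ j ∧ j ≤ n) :
    Commute (K n i) (Kbar n j) := by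
  simpa [commute_iff_eq, K, Kbar] using mk_rel (Rel.K_Kbar i j hi hj)

theorem K_mul_E {i j : ℕ} (hi : 1 ≤ i ∧ i ≤ n) (hj : 1 ≤ j ∧ j < n) :
    K n i * E n j = v ^ pair i j • (E n j * K n i) := by
  simpa [K, E] using mk_rel (Rel.K_E i j hi hj)

theorem K_mul_Ebar {i j : ℕ} (hi : 1 ≤ i ∧ i ≤ n) (hj : 1 ≤ j ∧ j < n) :
    K n i * Ebar n j = v ^ pair i j • (Ebar n j * K n i) := by
  simpa [K, Ebar] using mk_rel (Rel.K_Ebar i j hi hj)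

theorem K_mul_F {i j : ℕ} (hi : 1 ≤ i ∧ i ≤ n) (hj : 1 ≤ j ∧ j < n) :
    K n i * F n j = v ^ (-pair i j) • (F n j * K n i) := by
  simpa only [K, F, map_mul, map_smul] using mk_rel (Rel.K_F i j hi hj)

theorem Kbar_succ_mul_E {i : ℕ} (hi : 1 ≤ i ∧ i < n) :
    v • (Kbar n (i + 1) * E n i) - E n i * Kbar n (i + 1) = -(Kinv n (i + 1) * Ebar n i) := by
  simpa [Kbar, Kinv, E, Ebar] using mk_rel (Rel.Kbar_succ_E i hi)

theorem Kbar_succ_mul_F {i : ℕ} (hi : 1 ≤ i ∧ i < n) :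
    v • (Kbar n (i + 1) * F n i) - F n i * Kbar n (i + 1) = K n (i + 1) * Fbar n i := by
  simpa [Kbar, K, F, Fbar] using mk_rel (Rel.Kbar_succ_F i hi)

theorem commute_Kbar_E {i j : ℕ} (hi : 1 ≤ i ∧ i ≤ n) (hj : 1 ≤ j ∧ j < n)
    (hij : j ≠ i ∧ j + 1 ≠ i) : Commute (Kbar n i) (E n j) := by
  simpa [commute_iff_eq, Kbar, E, sub_eq_zero] using mk_rel (Rel.Kbar_E_far i j hi hj hij)

theorem commute_Kbar_F {i j : ℕ} (hi : 1 ≤ i ∧ i ≤ n) (hj : 1 ≤ j ∧ j < n)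
    (hij : j ≠ i ∧ j + 1 ≠ i) : Commute (Kbar n i) (F n j) := by
  simpa [commute_iff_eq, Kbar, F, sub_eq_zero] using mk_rel (Rel.Kbar_F_far i j hi hj hij)

theorem commute_E_F {i j : ℕ} (hi : 1 ≤ i ∧ i < n) (hj : 1 ≤ j ∧ j < n) (hij : i ≠ j) :
    Commute (E n i) (F n j) := by
  simpa [commute_iff_eq, E, F, δ, hij, sub_eq_zero] using mk_rel (Rel.E_F i j hi hj)

theorem commute_Ebar_F {i j : ℕ} (hi : 1 ≤ i ∧ i < n) (hj : 1 ≤ j ∧ j < n) (hij : i ≠ j) :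
    Commute (Ebar n i) (F n j) := by
  simpa [commute_iff_eq, Ebar, F, δ, hij, sub_eq_zero] using mk_rel (Rel.Ebar_F i j hi hj)

theorem F_mul_E {i : ℕ} (hi : 1 ≤ i ∧ i < n) :
    F n i * E n i - E n i * F n i =
      -((v - v⁻¹)⁻¹ • (K n i * Kinv n (i + 1) - Kinv n i * K n (i + 1))) := by
  have h := mk_rel (Rel.E_F i i hi hi)
  simp only [δ, if_true, map_sub, map_mul, map_smul, Int.cast_one, one_div] at h
  rw [← neg_sub]
  exact congrArg Neg.neg h

theorem F_mul_Ebar {i : ℕ} (hi : 1 ≤ i ∧ i < n) :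
    F n i * Ebar n i - Ebar n i * F n i =
      Kbar n (i + 1) * K n i - K n (i + 1) * Kbar n i := by
  have h := mk_rel (Rel.Ebar_F i i hi hi)
  simp only [δ, if_true, map_sub, map_mul, Int.cast_one, one_smul] at h
  rw [← neg_sub, ← neg_sub (K n (i + 1) * Kbar n i)]
  exact congrArg Neg.neg h

theorem commute_E_E {i j : ℕ} (hi : 1 ≤ i ∧ i < n) (hj : 1 ≤ j ∧ j < n)
    (hij : i + 1 < j ∨ j + 1 < i) : Commute (E n i) (E n j) := by
  simpa [commute_iff_eq, E, sub_eq_zero] using mk_rel (Rel.E_E_far i j hi hj hij)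

theorem commute_E_Ebar {i j : ℕ} (hi : 1 ≤ i ∧ i < n) (hj : 1 ≤ j ∧ j < n)
    (hij : i + 1 ≠ j ∧ j + 1 ≠ i) : Commute (E n i) (Ebar n j) := by
  simpa [commute_iff_eq, E, Ebar, sub_eq_zero] using mk_rel (Rel.E_Ebar_comm i j hi hj hij)

theorem commute_F_F {i j : ℕ} (hi : 1 ≤ i ∧ i < n) (hj : 1 ≤ j ∧ j < n)
    (hij : i + 1 < j ∨ j + 1 < i) : Commute (F n i) (F n j) := by
  simpa [commute_iff_eq, F, sub_eq_zero] using mk_rel (Rel.F_F_far i j hi hj hij)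

end Relations

/-! ### Recursion for the root vectors -/

section Recursion

variable (n : ℕ)

theorem rootE_simple (i : ℕ) : rootE n i (i + 1) = E n i := by
  simp [rootE, posRoot]

theorem rootEbar_simple (i : ℕ) : rootEbar n i (i + 1) = Ebar n i := by
  simp [rootEbar, posRootBar]

theorem rootE_neg_simple (i : ℕ) : rootE n (i + 1) i = F n i := by
  simp [rootE, negRoot]

theorem rootEbar_neg_simple (i : ℕ) : rootEbar n (i + 1) i = Fbar n i := by
  simp [rootEbar, negRootBar]

variable {i j : ℕ} (h : i < j)
include h

theorem rootE_succ : rootE n i (j + 1) =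
    -(rootE n i j * E n j) + v⁻¹ • (E n j * rootE n i j) := by
  obtain ⟨d, rfl⟩ := Nat.exists_eq_add_of_lt h
  simp [rootE, posRoot, show i < i + d + 1 by omega, show i < i + d + 1 + 1 by omega,
    show i + d + 1 - i - 1 = d by omega, show i + d + 1 + 1 - i - 1 = d + 1 by omega]

theorem rootEbar_succ : rootEbar n i (j + 1) =
    -(rootE n i j * Ebar n j) + v⁻¹ • (Ebar n j * rootE n i j) := by
  obtain ⟨d, rfl⟩ := Nat.exists_eq_add_of_lt h
  simp [rootE, rootEbar, posRootBar, show i < i + d + 1 by omega,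
    show i < i + d + 1 + 1 by omega,
    show i + d + 1 - i - 1 = d by omega, show i + d + 1 + 1 - i - 1 = d + 1 by omega]

theorem rootE_neg_succ : rootE n (j + 1) i =
    -(F n j * rootE n j i) + v • (rootE n j i * F n j) := by
  obtain ⟨d, rfl⟩ := Nat.exists_eq_add_of_lt h
  simp [rootE, negRoot, show i < i + d + 1 by omega, show i < i + d + 1 + 1 by omega,
    show ¬ i + d + 1 < i by omega, show ¬ i + d + 1 + 1 < i by omega,
    show i + d + 1 - i - 1 = d by omega, show i + d + 1 + 1 - i - 1 = d + 1 by omega]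

theorem rootEbar_neg_succ : rootEbar n (j + 1) i =
    -(Fbar n j * rootE n j i) + v • (rootE n j i * Fbar n j) := by
  obtain ⟨d, rfl⟩ := Nat.exists_eq_add_of_lt h
  simp [rootE, rootEbar, negRootBar, show i < i + d + 1 by omega,
    show i < i + d + 1 + 1 by omega,
    show ¬ i + d + 1 < i by omega, show ¬ i + d + 1 + 1 < i by omega,
    show i + d + 1 - i - 1 = d by omega, show i + d + 1 + 1 - i - 1 = d + 1 by omega]

end Recursion

/-! ### Commutation of an element with root vectors -/

section Commutation

variable {n : ℕ} {x : U n} {i j : ℕ}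

/-- E_{i,j} lies in the subalgebra generated by E_i, …, E_{j-1}. -/
theorem commute_rootE (hij : i < j) (hx : ∀ m, i ≤ m → m < j → Commute x (E n m)) :
    Commute x (rootE n i j) := by
  induction j, hij using Nat.le_induction with
  | base => simpa only [rootE_simple] using hx i le_rfl (Nat.lt_succ_self i)
  | succ j hij ih =>
    have h1 := ih fun m hm hm' => hx m hm (by omega)
    have h2 := hx j (by omega) (by omega)
    rw [rootE_succ n hij]
    exact ((h1.mul_right h2).neg_right).add_right ((h2.mul_right h1).smul_right _)

/-- In the recursion only the last letter carries the bar, so a single odd generator has to be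
tested. -/
theorem commute_rootEbar (hij : i ≤ j) (hx : ∀ m, i ≤ m → m < j → Commute x (E n m))
    (hx' : Commute x (Ebar n j)) : Commute x (rootEbar n i (j + 1)) := by
  rcases hij.eq_or_lt with rfl | hij
  · simpa only [rootEbar_simple] using hx'
  · have h1 := commute_rootE hij hx
    rw [rootEbar_succ n hij]
    exact ((h1.mul_right hx').neg_right).add_right ((hx'.mul_right h1).smul_right _)

theorem commute_rootE_neg (hij : i < j) (hx : ∀ m, i ≤ m → m < j → Commute x (F n m)) :
    Commute x (rootE n j i) := by
  induction j, hij using Nat.le_induction with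
  | base => simpa only [rootE_neg_simple] using hx i le_rfl (Nat.lt_succ_self i)
  | succ j hij ih =>
    have h1 := ih fun m hm hm' => hx m hm (by omega)
    have h2 := hx j (by omega) (by omega)
    rw [rootE_neg_succ n hij]
    exact ((h2.mul_right h1).neg_right).add_right ((h1.mul_right h2).smul_right _)

variable {k l m : ℕ}

theorem commute_Kbar_rootE (hi : 1 ≤ i) (hij : i < j) (hj : j ≤ n) (hm : 1 ≤ m ∧ m ≤ n)
    (h : m < i ∨ j < m) : Commute (Kbar n m) (rootE n i j) :=
  commute_rootE hij fun p _ _ => commute_Kbar_E hm (by omega) (by omega)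

theorem commute_Kbar_rootE_neg (hi : 1 ≤ i) (hij : i < j) (hj : j ≤ n) (hm : 1 ≤ m ∧ m ≤ n)
    (h : m < i ∨ j < m) : Commute (Kbar n m) (rootE n j i) :=
  commute_rootE_neg hij fun p _ _ => commute_Kbar_F hm (by omega) (by omega)

theorem commute_neg_E (hi : 1 ≤ i) (hij : i < j) (hj : j ≤ n) (hm : 1 ≤ m ∧ m < n)
    (h : j ≤ m ∨ m < i) : Commute (rootE n j i) (E n m) :=
  (commute_rootE_neg hij fun _ _ _ => commute_E_F hm (by omega) (by omega)).symm

theorem commute_neg_pos (hi : 1 ≤ i) (hij : i < j) (hj : j ≤ n) (hk : 1 ≤ k) (hkl : k < l)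
    (hl : l ≤ n) (h : j ≤ k ∨ l ≤ i) : Commute (rootE n j i) (rootE n k l) :=
  commute_rootE hkl fun p _ _ => commute_neg_E hi hij hj (by omega) (by omega)

theorem commute_neg_Ebar (hi : 1 ≤ i) (hij : i < j) (hj : j ≤ n) (hm : 1 ≤ m ∧ m < n)
    (h : j ≤ m ∨ m < i) : Commute (rootE n j i) (Ebar n m) :=
  (commute_rootE_neg hij fun _ _ _ => commute_Ebar_F hm (by omega) (by omega)).symm

theorem commute_neg_posBar (hi : 1 ≤ i) (hij : i < j) (hj : j ≤ n) (hk : 1 ≤ k) (hkl : k < l)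
    (hl : l ≤ n) (h : j ≤ k ∨ l ≤ i) : Commute (rootE n j i) (rootEbar n k l) := by
  obtain ⟨l, rfl⟩ : ∃ l', l = l' + 1 := ⟨l - 1, by omega⟩
  refine commute_rootEbar (by omega) (fun p _ _ => commute_neg_E hi hij hj ?_ ?_)
    (commute_neg_Ebar hi hij hj (by omega) (by omega)) <;> omega

theorem commute_neg_neg (hi : 1 ≤ i) (hij : i < j) (hj : j < k) (hkl : k < l)
    (hl : l ≤ n) : Commute (rootE n j i) (rootE n l k) :=
  commute_rootE_neg hkl fun p _ _ => (commute_rootE_neg hij fun q _ _ =>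
    commute_F_F (by omega) (by omega) (by omega)).symm

/-- The gap j < k makes all generators involved non-adjacent; for j = k the vectors would not
commute but combine to a longer root vector. -/
theorem commute_pos_posBar (hi : 1 ≤ i) (hij : i < j) (hj : j < k) (hkl : k < l)
    (hl : l ≤ n) : Commute (rootE n i j) (rootEbar n k l) := by
  obtain ⟨l, rfl⟩ : ∃ l', l = l' + 1 := ⟨l - 1, by omega⟩
  refine (commute_rootEbar (by omega) (fun p _ _ => ?_) ?_)
  · exact (commute_rootE hij fun q _ _ => commute_E_E (by omega) (by omega) (by omega)).symm
  · exact (commute_rootE hij fun q _ _ =>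
      (commute_E_Ebar (by omega) (by omega) (by omega)).symm).symm

end Commutation

/-! ### Weights -/

section Skew

variable {A : Type*} [Ring A] [Algebra Qv A] {k k' a b : A} {c d : Qv}

theorem skew_left_comm (h : a * b = c • (b * a)) (x : A) : a * (b * x) = c • (b * (a * x)) := by
  rw [← mul_assoc, h, smul_mul_assoc, mul_assoc]

theorem skew_mul (ha : k * a = c • (a * k)) (hb : k * b = d • (b * k)) :
    k * (a * b) = (c * d) • (a * b * k) := by
  rw [skew_left_comm ha, hb, mul_smul_comm, smul_smul, mul_assoc]

theorem skew_bracket (ha : k * a = c • (a * k)) (hb : k * b = d • (b * k)) (s : Qv) :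
    k * (-(a * b) + s • (b * a)) = (c * d) • ((-(a * b) + s • (b * a)) * k) := by
  rw [mul_add, mul_neg, mul_smul_comm, skew_mul ha hb, skew_mul hb ha, add_mul, neg_mul,
    smul_mul_assoc]
  module

theorem skew_inv (h : k * a = c • (a * k)) (hc : c ≠ 0) (h1 : k * k' = 1) (h2 : k' * k = 1) :
    k' * a = c⁻¹ • (a * k') := by
  have h3 : a * k = c⁻¹ • (k * a) := by rw [h, smul_smul, inv_mul_cancel₀ hc, one_smul]
  calc k' * a = k' * (a * k) * k' := by rw [mul_assoc, mul_assoc, h1, mul_one]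
    _ = _ := by rw [h3, mul_smul_comm, ← mul_assoc, h2, one_mul, smul_mul_assoc]

end Skew

section Weights

variable {n m i j : ℕ} (hm : 1 ≤ m ∧ m ≤ n) (hi : 1 ≤ i) (hij : i < j) (hj : j ≤ n)
include hm hi hij hj

theorem K_mul_rootE : K n m * rootE n i j = v ^ (δ m i - δ m j) • (rootE n i j * K n m) := by
  induction j, hij using Nat.le_induction with
  | base => simpa only [rootE_simple, pair] using K_mul_E hm (by omega)
  | succ j hij ih =>
    rw [rootE_succ n hij, skew_bracket (ih (by omega)) (K_mul_E hm (by omega)),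
      ← zpow_add₀ v_ne_zero]
    -- The weights telescope: (δ m i - δ m j) + (δ m j - δ m (j + 1)).
    simp [pair]

theorem K_mul_rootEbar :
    K n m * rootEbar n i j = v ^ (δ m i - δ m j) • (rootEbar n i j * K n m) := by
  obtain ⟨j, rfl⟩ : ∃ j', j = j' + 1 := ⟨j - 1, by omega⟩
  rcases (Nat.lt_succ_iff.1 hij).eq_or_lt with rfl | hij
  · simpa only [rootEbar_simple, pair] using K_mul_Ebar hm (by omega)
  · rw [rootEbar_succ n hij, skew_bracket (K_mul_rootE hm hi hij (by omega))
      (K_mul_Ebar hm (by omega)), ← zpow_add₀ v_ne_zero]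
    simp [pair]

theorem K_mul_rootE_neg :
    K n m * rootE n j i = v ^ (δ m j - δ m i) • (rootE n j i * K n m) := by
  induction j, hij using Nat.le_induction with
  | base => simpa only [rootE_neg_simple, pair, neg_sub] using K_mul_F hm (by omega)
  | succ j hij ih =>
    rw [rootE_neg_succ n hij, skew_bracket (K_mul_F hm (by omega)) (ih (by omega)),
      ← zpow_add₀ v_ne_zero]
    simp [pair]

end Weights

section Specialized

variable {n m i j : ℕ}

theorem Kinv_mul_of_K_mul {x : U n} {c : Qv} (hm : 1 ≤ m ∧ m ≤ n) (hc : c ≠ 0)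
    (h : K n m * x = c • (x * K n m)) : Kinv n m * x = c⁻¹ • (x * Kinv n m) :=
  skew_inv h hc (K_mul_Kinv hm) (Kinv_mul_K hm)

theorem commute_Kinv {x : U n} (hm : 1 ≤ m ∧ m ≤ n) (h : Commute (K n m) x) :
    Commute (Kinv n m) x := by
  have := Kinv_mul_of_K_mul hm one_ne_zero (h.eq.trans (one_smul Qv _).symm)
  rwa [inv_one, one_smul] at this

theorem commute_K_Kinv {l : ℕ} (hm : 1 ≤ m ∧ m ≤ n) (hl : 1 ≤ l ∧ l ≤ n) :
    Commute (K n m) (Kinv n l) :=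
  (commute_Kinv hl (commute_K_K hl hm)).symm

theorem commute_Kinv_Kinv {l : ℕ} (hm : 1 ≤ m ∧ m ≤ n) (hl : 1 ≤ l ∧ l ≤ n) :
    Commute (Kinv n m) (Kinv n l) :=
  commute_Kinv hm (commute_K_Kinv hm hl)

variable (hi : 1 ≤ i) (hij : i < j) (hj : j ≤ n)
include hi hij hj

theorem commute_K_rootE (hm : 1 ≤ m ∧ m ≤ n) (hmi : m ≠ i) (hmj : m ≠ j) :
    Commute (K n m) (rootE n i j) := by
  simpa [commute_iff_eq, δ, hmi, hmj] using K_mul_rootE hm hi hij hj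

theorem commute_K_rootE_neg (hm : 1 ≤ m ∧ m ≤ n) (hmi : m ≠ i) (hmj : m ≠ j) :
    Commute (K n m) (rootE n j i) := by
  simpa [commute_iff_eq, δ, hmi, hmj] using K_mul_rootE_neg hm hi hij hj

theorem commute_K_rootEbar (hm : 1 ≤ m ∧ m ≤ n) (hmi : m ≠ i) (hmj : m ≠ j) :
    Commute (K n m) (rootEbar n i j) := by
  simpa [commute_iff_eq, δ, hmi, hmj] using K_mul_rootEbar hm hi hij hj

theorem K_left_rootE : K n i * rootE n i j = v • (rootE n i j * K n i) := by
  simpa [δ, hij.ne] using K_mul_rootE (m := i) (by omega) hi hij hj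

theorem K_right_rootE : K n j * rootE n i j = v⁻¹ • (rootE n i j * K n j) := by
  simpa [δ, hij.ne'] using K_mul_rootE (m := j) (by omega) hi hij hj

theorem K_left_rootEbar : K n i * rootEbar n i j = v • (rootEbar n i j * K n i) := by
  simpa [δ, hij.ne] using K_mul_rootEbar (m := i) (by omega) hi hij hj

theorem K_right_rootE_neg : K n j * rootE n j i = v • (rootE n j i * K n j) := by
  simpa [δ, hij.ne'] using K_mul_rootE_neg (m := j) (by omega) hi hij hj

theorem K_left_rootE_neg : K n i * rootE n j i = v⁻¹ • (rootE n j i * K n i) := by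
  simpa [δ, hij.ne] using K_mul_rootE_neg (m := i) (by omega) hi hij hj

theorem Kinv_left_rootE : Kinv n i * rootE n i j = v⁻¹ • (rootE n i j * Kinv n i) :=
  Kinv_mul_of_K_mul (by omega) v_ne_zero (K_left_rootE hi hij hj)

theorem Kinv_right_rootE : Kinv n j * rootE n i j = v • (rootE n i j * Kinv n j) := by
  simpa using Kinv_mul_of_K_mul (by omega) (inv_ne_zero v_ne_zero) (K_right_rootE hi hij hj)

theorem Kinv_left_rootEbar : Kinv n i * rootEbar n i j = v⁻¹ • (rootEbar n i j * Kinv n i) :=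
  Kinv_mul_of_K_mul (by omega) v_ne_zero (K_left_rootEbar hi hij hj)

theorem Kinv_right_rootE_neg : Kinv n j * rootE n j i = v⁻¹ • (rootE n j i * Kinv n j) :=
  Kinv_mul_of_K_mul (by omega) v_ne_zero (K_right_rootE_neg hi hij hj)

theorem Kinv_left_rootE_neg : Kinv n i * rootE n j i = v • (rootE n j i * Kinv n i) := by
  simpa using Kinv_mul_of_K_mul (by omega) (inv_ne_zero v_ne_zero) (K_left_rootE_neg hi hij hj)

end Specialized

/-! ### Splitting root vectors at an intermediate index -/

section Splitting

section Abstract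

variable {A : Type*} [Ring A] [Algebra Qv A] {a b e : A}

/-- Associativity of the skew bracket: in the difference of the two sides only the terms with a and
e adjacent survive, and these cancel because a and e commute. -/
theorem bracket_bracket (h : Commute a e) (s : Qv) :
    -((-(a * b) + s • (b * a)) * e) + s • (e * (-(a * b) + s • (b * a))) =
      -(a * (-(b * e) + s • (e * b))) + s • ((-(b * e) + s • (e * b)) * a) := by
  simp only [mul_add, add_mul, mul_neg, neg_mul, smul_add, smul_neg, smul_mul_assoc,
    mul_smul_comm, smul_smul, mul_assoc, h.eq, h.left_comm]
  module

end Abstract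

variable {n i m j : ℕ} (hi : 1 ≤ i) (him : i < m) (hmj : m < j) (hj : j ≤ n)
include hi him hmj hj

theorem rootE_split : rootE n i j =
    -(rootE n i m * rootE n m j) + v⁻¹ • (rootE n m j * rootE n i m) := by
  induction j, hmj using Nat.le_induction with
  | base => rw [rootE_succ n him, rootE_simple]
  | succ j hmj ih =>
    have hc : Commute (rootE n i m) (E n j) := (commute_rootE him fun q _ _ =>
      (commute_E_E (by omega) (by omega) (by omega))).symm
    rw [rootE_succ n (him.trans hmj), rootE_succ n hmj, ih (by omega), bracket_bracket hc]

theorem rootEbar_split : rootEbar n i j =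
    -(rootE n i m * rootEbar n m j) + v⁻¹ • (rootEbar n m j * rootE n i m) := by
  obtain ⟨j, rfl⟩ : ∃ j', j = j' + 1 := ⟨j - 1, by omega⟩
  rcases (Nat.lt_succ_iff.1 hmj).eq_or_lt with rfl | hmj
  · rw [rootEbar_succ n him, rootEbar_simple]
  · have hc : Commute (rootE n i m) (Ebar n j) := (commute_rootE him fun q _ _ =>
      (commute_E_Ebar (by omega) (by omega) (by omega)).symm).symm
    rw [rootEbar_succ n (him.trans hmj), rootEbar_succ n hmj,
      rootE_split hi him hmj (by omega), bracket_bracket hc]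

theorem rootE_neg_split : rootE n j i =
    -(rootE n j m * rootE n m i) + v • (rootE n m i * rootE n j m) := by
  induction j, hmj using Nat.le_induction with
  | base => rw [rootE_neg_succ n him, rootE_neg_simple]
  | succ j hmj ih =>
    have hc : Commute (F n j) (rootE n m i) := commute_rootE_neg him fun q _ _ =>
      (commute_F_F (by omega) (by omega) (by omega))
    -- Negative recursion attaches the new generator on the left, so `bracket_bracket` is read from
    -- right to left with `F n j` as its first entry.
    rw [rootE_neg_succ n (him.trans hmj), rootE_neg_succ n hmj, ih (by omega),
      ← bracket_bracket hc]

end Splitting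

/-! ### Odd root vectors as skew commutators with `Kbar` -/

section Abstract

variable {A : Type*} [Ring A] [Algebra Qv A] {a e ebar κ k : A} {s t : Qv}

/-- A twisted Leibniz rule: κ and k pass through a, so they see only the factor e, and the bar moves
from e to the whole bracket. -/
theorem skew_Kbar_bracket (ha : Commute κ a) (hk : Commute k a)
    (he : κ * e = s • (e * κ) + t • (k * ebar)) (r : Qv) :
    κ * (-(a * e) + r • (e * a)) =
      s • ((-(a * e) + r • (e * a)) * κ) + t • (k * (-(a * ebar) + r • (ebar * a))) := by
  have he' (x : A) : κ * (e * x) = s • (e * (κ * x)) + t • (k * (ebar * x)) := by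
    rw [← mul_assoc, he, add_mul, smul_mul_assoc, smul_mul_assoc, mul_assoc, mul_assoc]
  simp only [mul_add, add_mul, mul_neg, neg_mul, smul_add, smul_neg, smul_mul_assoc,
    mul_smul_comm, smul_smul, mul_assoc, he, he', ha.eq, ha.left_comm, hk.eq, hk.left_comm]
  module

theorem skew_Kbar_bracket' (ha : Commute κ a) (hk : Commute k a)
    (he : κ * e = s • (e * κ) + t • (k * ebar)) (r : Qv) :
    κ * (-(e * a) + r • (a * e)) =
      s • ((-(e * a) + r • (a * e)) * κ) + t • (k * (-(ebar * a) + r • (a * ebar))) := by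
  have he' (x : A) : κ * (e * x) = s • (e * (κ * x)) + t • (k * (ebar * x)) := by
    rw [← mul_assoc, he, add_mul, smul_mul_assoc, smul_mul_assoc, mul_assoc, mul_assoc]
  simp only [mul_add, add_mul, mul_neg, neg_mul, smul_add, smul_neg, smul_mul_assoc,
    mul_smul_comm, smul_smul, mul_assoc, he, he', ha.eq, ha.left_comm, hk.eq, hk.left_comm]
  module

theorem eq_of_smul_sub_eq {x y z : A} (h : v • x - y = z) : x = v⁻¹ • y + v⁻¹ • z := by
  rw [← smul_add, eq_inv_smul_iff₀ v_ne_zero, ← h, add_sub_cancel]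

end Abstract

section KbarBracket

variable {n i j : ℕ} (hi : 1 ≤ i) (hij : i < j) (hj : j ≤ n)
include hi hij hj

/-- K̄_j commutes with E_{i,j-1} and interacts only with the last generator E_{j-1}, which is
exactly the one that the recursion bars. -/
theorem Kbar_mul_rootE : Kbar n j * rootE n i j =
    v⁻¹ • (rootE n i j * Kbar n j) + (-v⁻¹) • (Kinv n j * rootEbar n i j) := by
  obtain ⟨j, rfl⟩ : ∃ j', j = j' + 1 := ⟨j - 1, by omega⟩
  have h1 := eq_of_smul_sub_eq (Kbar_succ_mul_E (n := n) (i := j) (by omega))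
  rw [smul_neg, ← neg_smul] at h1
  rcases (Nat.lt_succ_iff.1 hij).eq_or_lt with rfl | hij
  · rwa [rootE_simple, rootEbar_simple]
  · rw [rootE_succ n hij, rootEbar_succ n hij]
    exact skew_Kbar_bracket (commute_Kbar_rootE hi hij (by omega) (by omega) (by omega))
      (commute_Kinv (by omega)
        (commute_K_rootE hi hij (by omega) (by omega) (by omega) (by omega))) h1 _

theorem Kbar_mul_rootE_neg : Kbar n j * rootE n j i =
    v⁻¹ • (rootE n j i * Kbar n j) + v⁻¹ • (K n j * rootEbar n j i) := by
  obtain ⟨j, rfl⟩ : ∃ j', j = j' + 1 := ⟨j - 1, by omega⟩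
  have h1 := eq_of_smul_sub_eq (Kbar_succ_mul_F (n := n) (i := j) (by omega))
  rcases (Nat.lt_succ_iff.1 hij).eq_or_lt with rfl | hij
  · rwa [rootE_neg_simple, rootEbar_neg_simple]
  · rw [rootE_neg_succ n hij, rootEbar_neg_succ n hij]
    exact skew_Kbar_bracket' (commute_Kbar_rootE_neg hi hij (by omega) (by omega) (by omega))
      (commute_K_rootE_neg hi hij (by omega) (by omega) (by omega) (by omega)) h1 _

end KbarBracket

/-- If `ebar` and `fbar` are the skew commutators of `e` and `f` with `κ`, then the difference of
the two mixed commutators only involves the commutator of `f` and `e`. -/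
theorem mixed_commutator {A : Type*} [Ring A] [Algebra Qv A] {e f ebar fbar κ k k' : A}
    (h1 : k * k' = 1) (h2 : k' * k = 1) (hκ : k * κ = κ * k)
    (he : k * e = v⁻¹ • (e * k)) (hf : k * f = v • (f * k))
    (hebar : κ * e = v⁻¹ • (e * κ) + (-v⁻¹) • (k' * ebar))
    (hfbar : κ * f = v⁻¹ • (f * κ) + v⁻¹ • (k * fbar)) :
    f * ebar = ebar * f + fbar * e * k ^ 2 - e * fbar * k ^ 2 +
      k * (v⁻¹ • ((f * e - e * f) * κ) - v • (κ * (f * e - e * f))) := by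
  have hv := v_ne_zero
  have he' := skew_inv he (inv_ne_zero hv) h1 h2
  have hf' := skew_inv hf hv h1 h2
  have hκ' : k' * κ = κ * k' := (Commute.units_inv_left (u := ⟨k, k', h1, h2⟩) hκ).eq
  -- Both hypotheses are solved for the odd elements, which are then eliminated from the identity.
  have e1 : ebar = k * (e * κ - v • (κ * e)) := by
    rw [hebar, neg_smul, smul_add, smul_neg, smul_inv_smul₀ hv, smul_inv_smul₀ hv,
      ← sub_eq_add_neg, sub_sub_cancel, ← mul_assoc, h1,
      one_mul]
  have f1 : fbar = k' * (v • (κ * f) - f * κ) := by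
    rw [hfbar, smul_add, smul_inv_smul₀ hv, smul_inv_smul₀ hv, add_sub_cancel_left, ← mul_assoc, h2,
      one_mul]
  have hk (x : A) : k' * (k * x) = x := by rw [← mul_assoc, h2, one_mul]
  have hk2 (x : A) : k * (κ * x) = κ * (k * x) := by rw [← mul_assoc, hκ, mul_assoc]
  have hk3 (x : A) : k' * (κ * x) = κ * (k' * x) := by rw [← mul_assoc, hκ', mul_assoc]
  rw [e1, f1]
  -- With k moved to the left, the terms fκe and eκf occur twice with opposite signs; the others
  -- pair up to (fe - ef)κ and κ(fe - ef).
  simp only [mul_add, add_mul, mul_sub, sub_mul, smul_add, smul_sub, smul_mul_assoc,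
    mul_smul_comm, smul_smul, mul_assoc, pow_two, hκ, hκ', hk, hk2, hk3, he, he', hf, hf',
    skew_left_comm he, skew_left_comm he', skew_left_comm hf, skew_left_comm hf']
  match_scalars <;> field_simp <;> ring

theorem mixed_commutator_rootE {n i j k : ℕ} (hi : 1 ≤ i) (hij : i < j) (hk : 1 ≤ k) (hkj : k < j)
    (hj : j ≤ n) :
    rootE n j i * rootEbar n k j = rootEbar n k j * rootE n j i
      + rootEbar n j i * rootE n k j * K n j ^ 2 - rootE n k j * rootEbar n j i * K n j ^ 2
      + K n j * (v⁻¹ • ((rootE n j i * rootE n k j - rootE n k j * rootE n j i) * Kbar n j)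
        - v • (Kbar n j * (rootE n j i * rootE n k j - rootE n k j * rootE n j i))) :=
  mixed_commutator (K_mul_Kinv (by omega)) (Kinv_mul_K (by omega))
    (commute_K_Kbar (by omega) (by omega)) (K_right_rootE hk hkj hj)
    (K_right_rootE_neg hi hij hj) (Kbar_mul_rootE hk hkj hj) (Kbar_mul_rootE_neg hi hij hj)

/-! ### Commutators with skew brackets -/

section Abstract

variable {A : Type*} [Ring A] [Algebra Qv A]

theorem commutator_bracket {x a b y z : A} (hy : x * a - a * x = y) (hz : x * b - b * x = z)
    (s : Qv) :
    x * (-(a * b) + s • (b * a)) - (-(a * b) + s • (b * a)) * x =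
      (-(y * b) + s • (b * y)) + (-(a * z) + s • (z * a)) := by
  subst hy hz
  simp only [mul_add, add_mul, mul_neg, neg_mul, mul_sub, sub_mul, smul_add, smul_sub, smul_neg,
    smul_mul_assoc, mul_smul_comm, mul_assoc]
  module

theorem bracket_commutator {x a b y z : A} (hy : a * x - x * a = y) (hz : b * x - x * b = z)
    (s : Qv) :
    (-(a * b) + s • (b * a)) * x - x * (-(a * b) + s • (b * a)) =
      (-(y * b) + s • (b * y)) + (-(a * z) + s • (z * a)) := by
  subst hy hz
  simp only [mul_add, add_mul, mul_neg, neg_mul, mul_sub, sub_mul, smul_add, smul_sub, smul_neg,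
    smul_mul_assoc, mul_smul_comm, mul_assoc]
  module

theorem bracket_zero_left (a : A) (s : Qv) : -(0 * a) + s • (a * 0) = (0 : A) := by simp

theorem bracket_zero_right (a : A) (s : Qv) : -(a * 0) + s • (0 * a) = (0 : A) := by simp

/-- The vanishing mechanism: a skew bracket is zero when its parameter is inverse to the factor by
which its entries skew-commute. -/
theorem bracket_eq_zero {a b : A} {s t : Qv} (h : b * a = t • (a * b)) (hst : s * t = 1) :
    -(a * b) + s • (b * a) = 0 := by
  rw [h, smul_smul, hst, one_smul, neg_add_cancel]

theorem mul_skew_of_commute {x y b : A} {c : Qv} (hx : Commute x b) (hy : y * b = c • (b * y)) :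
    x * y * b = c • (b * (x * y)) := by
  rw [mul_assoc, hy, mul_smul_comm, ← mul_assoc, hx.eq, mul_assoc]

theorem mul_commute_of_skew {x y b : A} {c : Qv} (hx : x * b = c • (b * x)) (hy : Commute y b) :
    x * y * b = c • (b * (x * y)) := by
  rw [mul_assoc, hy.eq, ← mul_assoc, hx, smul_mul_assoc, mul_assoc]

omit [Algebra Qv A] in
theorem mul_mul_mul_cancel {d h p q h' : A} (hh : h * h' = 1) (hp : Commute h' p)
    (hq : Commute h' q) (hpq : Commute p q) : d * h * p * q * h' = d * q * p := by
  rw [mul_assoc _ q, ← hq.eq, mul_assoc (d * h), ← mul_assoc p, ← hp.eq, mul_assoc h', mul_assoc d,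
    ← mul_assoc h, hh, one_mul, mul_assoc, hpq.eq]

theorem neg_smul_mul_mul_mul_cancel {d h p q h' : A} (s : Qv) (hh : h * h' = 1)
    (hp : Commute h' p) (hq : Commute h' q) (hpq : Commute p q) :
    -(s • (d * h * p)) * q * h' = -(s • (d * q * p)) := by
  rw [neg_mul, neg_mul, smul_mul_assoc, smul_mul_assoc, mul_mul_mul_cancel hh hp hq hpq]

/-! ### Skew brackets with the Cartan element. -/

section Cartan

variable {a k k' l l' : A}

-- With k = K_i and l = K_j this is the value of [E_{j,i}, E_{i,j}].
local notation "g" => -((v - v⁻¹)⁻¹ • (k * l' - k' * l))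

/-- As in its three companions, the two group-like summands of `g` have opposite weights on a. The
bracket kills one of them, and the coefficient of the other cancels the denominator v - v⁻¹. -/
theorem cartan_bracket_neg_left (hk : k * a = v • (a * k)) (hk' : k' * a = v⁻¹ • (a * k'))
    (hl : Commute l a) (hl' : Commute l' a) (hkl : Commute k' l) :
    -(g * a) + v • (a * g) = a * l * k' := by
  have hv := v_ne_zero
  have hv' := v_sq_sub_one_ne_zero
  simp only [mul_neg, neg_mul, mul_sub, sub_mul, smul_sub, smul_neg, smul_mul_assoc, mul_smul_comm,
    smul_smul, mul_assoc, hl.eq, hl'.eq, hl.left_comm, hk', skew_left_comm hk, skew_left_comm hk', hkl.eq]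
  match_scalars <;> field_simp <;> ring

theorem cartan_bracket_neg_right (hl : l * a = v⁻¹ • (a * l)) (hl' : l' * a = v • (a * l'))
    (hk : Commute k a) (hk' : Commute k' a) :
    -(a * g) + v • (g * a) = -(v • (a * k * l')) := by
  have hv := v_ne_zero
  have hv' := v_sq_sub_one_ne_zero
  simp only [mul_neg, neg_mul, mul_sub, sub_mul, smul_sub, smul_neg, smul_mul_assoc, mul_smul_comm,
    smul_smul, mul_assoc, hl, hl', hk.left_comm, hk'.left_comm]
  match_scalars <;> field_simp <;> ring

theorem cartan_bracket_pos_left (hl : l * a = v • (a * l)) (hl' : l' * a = v⁻¹ • (a * l'))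
    (hk : Commute k a) (hk' : Commute k' a) (hkl : Commute k' l) :
    -(g * a) + v⁻¹ • (a * g) = -(a * l * k') := by
  have hv := v_ne_zero
  have hv' := v_sq_sub_one_ne_zero
  simp only [mul_neg, neg_mul, mul_sub, sub_mul, smul_sub, smul_neg, smul_mul_assoc, mul_smul_comm,
    smul_smul, mul_assoc, hl, hl', hk.left_comm, hk'.left_comm, hk'.eq, skew_left_comm hl, hkl.eq]
  match_scalars <;> field_simp <;> ring

theorem cartan_bracket_pos_right (hk : k * a = v⁻¹ • (a * k)) (hk' : k' * a = v • (a * k'))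
    (hl : Commute l a) (hl' : Commute l' a) :
    -(a * g) + v⁻¹ • (g * a) = v⁻¹ • (a * k * l') := by
  have hv := v_ne_zero
  have hv' := v_sq_sub_one_ne_zero
  simp only [mul_neg, neg_mul, mul_sub, sub_mul, smul_sub, smul_neg, smul_mul_assoc, mul_smul_comm,
    smul_smul, mul_assoc, hl.eq, hl'.eq, skew_left_comm hk, skew_left_comm hk']
  match_scalars <;> field_simp <;> ring

/-- Telescoping for h = K_j between k = K_i and l = K_{j+1}: the two products h⁻¹lkh⁻¹ and kh⁻¹lh⁻¹
cancel. -/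
theorem cartan_step {h h' : A} (hh : h * h' = 1) (h1 : Commute h' l') (h2 : Commute h' k)
    (h3 : Commute h' l) (h4 : Commute k l) (h5 : Commute k l') :
    -((v - v⁻¹)⁻¹ • (h * l' - h' * l)) * k * h' + -((v - v⁻¹)⁻¹ • (k * h' - k' * h)) * l * h' =
      g := by
  have e1 : h * l' * k * h' = k * l' := by
    simpa using mul_mul_mul_cancel (d := 1) hh h1 h2 h5.symm
  have e2 : h' * l * k * h' = k * h' * l * h' := by
    rw [mul_assoc h', ← h4.eq, ← mul_assoc, h2.eq]
  have e3 : k' * h * l * h' = k' * l := by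
    rw [mul_assoc _ l, ← h3.eq, mul_assoc, ← mul_assoc h, hh, one_mul]
  simp only [neg_mul, smul_mul_assoc, sub_mul, e1, e2, e3]
  module

theorem cartan_Kbar {κ : A} (hk : Commute κ k) (hk' : Commute κ k') (hl : Commute κ l)
    (hl' : Commute κ l') (h1 : Commute l k) (h2 : Commute l k') (hll : l * l' = 1) :
    l * (v⁻¹ • (g * κ) - v • (κ * g)) = -(κ * k' * l ^ 2) + κ * k := by
  have hv := v_ne_zero
  have hv' := v_sq_sub_one_ne_zero
  simp only [mul_neg, neg_mul, mul_sub, sub_mul, smul_sub, smul_neg, smul_mul_assoc, mul_smul_comm,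
    smul_smul, mul_assoc, pow_two, hk.symm.eq, hk'.symm.eq, hl.symm.eq, hl'.symm.eq,
    hk.symm.left_comm, hk'.symm.left_comm, hl.symm.left_comm, h1.left_comm, h2.left_comm, hll,
    mul_one]
  match_scalars <;> field_simp <;> ring

end Cartan

/-- The factor h' contributes v⁻¹, which balances the two coefficients: the skew bracket becomes an
ordinary commutator times a Cartan factor. This and `bracket_of_right` drive the inductions on root
length. -/
theorem bracket_of_left {d e w k h' : A} (hw : d * e - e * d = w) (hk : Commute k e)
    (hh : h' * e = v⁻¹ • (e * h')) :
    -(-(v • (d * k * h')) * e) + v⁻¹ • (e * -(v • (d * k * h'))) = w * k * h' := by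
  have hv := v_ne_zero
  subst hw
  simp only [mul_neg, neg_mul, sub_mul, smul_neg, smul_mul_assoc, mul_smul_comm,
    smul_smul, mul_assoc, hh, hk.left_comm]
  match_scalars
  all_goals field_simp

theorem bracket_of_right {d a w l h' : A} (hw : d * a - a * d = w) (hl : Commute l a)
    (hh : h' * a = v • (a * h')) :
    -(a * (d * l * h')) + v⁻¹ • (d * l * h' * a) = w * l * h' := by
  have hv := v_ne_zero
  subst hw
  simp only [sub_mul, smul_mul_assoc, mul_smul_comm,
    smul_smul, mul_assoc, hh, hl.left_comm]
  match_scalars <;> field_simp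

/-! ### Skew brackets and commutators involving K̄. -/

variable {a b k k' l l' κ κ' : A}

theorem Kbar_bracket_left (hk : k * a = v • (a * k)) (hl : Commute l a) (hκ' : Commute κ' a) :
    -((κ' * k - l * κ) * a) + v • (a * (κ' * k - l * κ)) = l * (κ * a - v • (a * κ)) := by
  simp only [mul_sub, sub_mul, smul_sub, smul_mul_assoc, mul_smul_comm, smul_smul, mul_assoc, hk,
    hl.left_comm, hκ'.left_comm]
  module

theorem Kbar_bracket_right (hl : l * b = v⁻¹ • (b * l)) (hk : Commute k b) (hκ : Commute κ b) :
    -(b * (κ' * k - l * κ)) + v • ((κ' * k - l * κ) * b) = (v • (κ' * b) - b * κ') * k := by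
  have hv := v_ne_zero
  simp only [mul_sub, sub_mul, smul_sub, smul_mul_assoc, mul_smul_comm, smul_smul, mul_assoc, hk.eq,
    hκ.eq, skew_left_comm hl]
  match_scalars <;> field_simp <;> ring

theorem cross_bracket (ha : Commute b a) (hl : l * b = v • (b * l)) (hk' : Commute k' b) :
    -(a * l * k' * b) + v⁻¹ • (b * (a * l * k')) = -((v - v⁻¹) • (a * b * l * k')) := by
  simp only [smul_mul_assoc, mul_smul_comm, smul_smul, mul_assoc, hk'.eq, skew_left_comm hl,
    ha.left_comm]
  module

/-- Moving a across k turns the bracket into multiplication by v⁻² - 1; on the summand with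
coefficient v this becomes -(v - v⁻¹). -/
theorem Kbar_cross_bracket {d : A} (hκ : Commute a κ) (hd : Commute a d)
    (hk : k * a = v⁻¹ • (a * k)) :
    -(a * ((v • (κ * d) - d * κ) * k)) + v⁻¹ • ((v • (κ * d) - d * κ) * k * a) =
      -((v - v⁻¹) • (κ * d * a * k)) + (1 - v⁻¹ ^ 2) • (d * κ * a * k) := by
  have hv := v_ne_zero
  simp only [mul_sub, sub_mul, smul_sub, smul_mul_assoc, mul_smul_comm, smul_smul, mul_assoc, hk,
    hκ.left_comm, hd.left_comm]
  match_scalars <;> field_simp <;> ring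

/-- Here κ commutes with everything, so the twisted difference is multiplication by v⁻¹ - v. -/
theorem Kbar_commutator_lower (ha : Commute κ a) (hl : Commute κ l) (hk' : Commute κ k')
    (hla : Commute l a) (hlk : Commute k' l) :
    l * (v⁻¹ • (a * l * k' * κ) - v • (κ * (a * l * k'))) =
      -((v - v⁻¹) • (a * κ * k' * l ^ 2)) := by
  simp only [mul_sub, smul_sub, mul_smul_comm, smul_smul, mul_assoc, pow_two, ha.left_comm,
    hl.symm.left_comm, hk'.symm.eq, hla.left_comm, hlk.eq, hlk.left_comm]
  module

theorem Kbar_commutator_upper (ha : Commute κ a) (hk : Commute κ k) (hl' : Commute κ l')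
    (hla : Commute l a) (hlk : Commute l k) (hl : Commute κ l) (hll : l * l' = 1) :
    l * (v⁻¹ • (v⁻¹ • (a * k * l') * κ) - v • (κ * v⁻¹ • (a * k * l'))) =
      -((1 - v⁻¹ ^ 2) • (a * k * κ)) := by
  have hv := v_ne_zero
  simp only [mul_sub, smul_sub, smul_mul_assoc, mul_smul_comm, smul_smul, mul_assoc, ha.left_comm,
    hk.left_comm, hl'.symm.eq, hl.symm.left_comm, hk.eq, hla.left_comm,
    hlk.left_comm, hll, mul_one]
  match_scalars <;> field_simp <;> ring

end Abstract

/-! ### Commutators of a negative root vector with positive root vectors -/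

section Commutators

variable {n i j k l m : ℕ}

theorem commutator_simple_right (hi : 1 ≤ i) (him : i < m) (hm : m < n) :
    rootE n (m + 1) i * E n m - E n m * rootE n (m + 1) i =
      rootE n m i * K n (m + 1) * Kinv n m := by
  rw [rootE_neg_succ n him, bracket_commutator (F_mul_E (by omega))
    (sub_eq_zero.2 (commute_neg_E hi him hm.le (by omega) (by omega)).eq), bracket_zero_right,
    add_zero]
  exact cartan_bracket_neg_left (K_right_rootE_neg hi him hm.le)
    (Kinv_right_rootE_neg hi him hm.le)
    (commute_K_rootE_neg hi him hm.le (by omega) (by omega) (by omega))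
    (commute_Kinv (by omega)
      (commute_K_rootE_neg hi him hm.le (by omega) (by omega) (by omega)))
    (commute_K_Kinv (by omega) (by omega)).symm

theorem commutator_simple_left (hi : 1 ≤ i) (hij : i + 1 < j) (hj : j ≤ n) :
    rootE n j i * E n i - E n i * rootE n j i =
      -(v • (rootE n j (i + 1) * K n i * Kinv n (i + 1))) := by
  rw [rootE_neg_split hi (Nat.lt_succ_self i) hij hj, rootE_neg_simple, bracket_commutator
    (sub_eq_zero.2 (commute_neg_E (by omega) hij hj (by omega) (by omega)).eq)
    (F_mul_E (by omega)), bracket_zero_left, zero_add]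
  have h := commute_K_rootE_neg (m := i) (by omega) hij hj (by omega) (by omega) (by omega)
  exact cartan_bracket_neg_right (K_left_rootE_neg (by omega) hij hj)
    (Kinv_left_rootE_neg (by omega) hij hj) h (commute_Kinv (by omega) h)

/-- Cutting at m + 1, the commutator of the lower piece with E_m is E_{m,i} K_{m+1} K_m⁻¹. Only
K_{m+1} fails to commute with the upper piece E_{j,m+1}, and its factor v⁻¹ makes the bracket
vanish. -/
theorem commute_simple_middle (hi : 1 ≤ i) (him : i < m) (hmj : m + 1 < j) (hj : j ≤ n) :
    Commute (rootE n j i) (E n m) := by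
  refine sub_eq_zero.1 ?_
  rw [rootE_neg_split hi (him.trans (Nat.lt_succ_self m)) hmj hj, bracket_commutator
    (sub_eq_zero.2 (commute_neg_E (by omega) hmj hj (by omega) (by omega)).eq)
    (commutator_simple_right hi him (by omega)), bracket_zero_left, zero_add]
  refine bracket_eq_zero (mul_commute_of_skew (mul_skew_of_commute
    (commute_neg_neg hi him (Nat.lt_succ_self m) hmj hj)
    (K_left_rootE_neg (by omega) hmj hj)) (commute_Kinv (by omega)
    (commute_K_rootE_neg (by omega) hmj hj (by omega) (by omega) (by omega))))
    (mul_inv_cancel₀ v_ne_zero)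

theorem commutator_bar_simple_left (hi : 1 ≤ i) (hij : i + 1 < j) (hj : j ≤ n) :
    rootE n j i * Ebar n i - Ebar n i * rootE n j i =
      (v • (Kbar n (i + 1) * rootE n j (i + 1)) - rootE n j (i + 1) * Kbar n (i + 1)) * K n i := by
  rw [rootE_neg_split hi (Nat.lt_succ_self i) hij hj, rootE_neg_simple, bracket_commutator
    (sub_eq_zero.2 (commute_neg_Ebar (by omega) hij hj (by omega) (by omega)).eq)
    (F_mul_Ebar (by omega)), bracket_zero_left, zero_add]
  exact Kbar_bracket_right (K_left_rootE_neg (by omega) hij hj)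
    (commute_K_rootE_neg (by omega) hij hj (by omega) (by omega) (by omega))
    (commute_Kbar_rootE_neg (by omega) hij hj (by omega) (by omega))

theorem commute_bar_simple_middle (hi : 1 ≤ i) (him : i < m) (hmj : m + 1 < j) (hj : j ≤ n) :
    Commute (rootE n j i) (Ebar n m) := by
  -- The second factor need not be evaluated: it commutes with E_{j,m+1}, and K_{m+1} alone supplies
  -- the factor v⁻¹.
  have h : rootE n (m + 1) i * Ebar n m - Ebar n m * rootE n (m + 1) i = K n (m + 1) *
      (Kbar n m * rootE n m i - v • (rootE n m i * Kbar n m)) := by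
    rw [rootE_neg_succ n him, bracket_commutator (F_mul_Ebar (by omega))
      (sub_eq_zero.2 (commute_neg_Ebar hi him (by omega) (by omega) (by omega)).eq),
      bracket_zero_right, add_zero]
    exact Kbar_bracket_left (K_right_rootE_neg hi him (by omega))
      (commute_K_rootE_neg hi him (by omega) (by omega) (by omega) (by omega))
      (commute_Kbar_rootE_neg hi him (by omega) (by omega) (by omega))
  refine sub_eq_zero.1 ?_
  rw [rootE_neg_split hi (him.trans (Nat.lt_succ_self m)) hmj hj, bracket_commutator
    (sub_eq_zero.2 (commute_neg_Ebar (by omega) hmj hj (by omega) (by omega)).eq) h,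
    bracket_zero_left, zero_add]
  have h1 : Commute (Kbar n m) (rootE n j (m + 1)) :=
    commute_Kbar_rootE_neg (by omega) hmj hj (by omega) (by omega)
  have h2 : Commute (rootE n m i) (rootE n j (m + 1)) :=
    commute_neg_neg hi him (Nat.lt_succ_self m) hmj hj
  exact bracket_eq_zero (mul_commute_of_skew (K_left_rootE_neg (by omega) hmj hj)
    ((h1.mul_left h2).sub_left ((h2.mul_left h1).smul_left v))) (mul_inv_cancel₀ v_ne_zero)

theorem commutator_left (hi : 1 ≤ i) (hil : i < l) (hlj : l < j) (hj : j ≤ n) :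
    rootE n j i * rootE n i l - rootE n i l * rootE n j i =
      -(v • (rootE n j l * K n i * Kinv n l)) := by
  induction l, hil using Nat.le_induction with
  | base =>
    rw [Nat.succ_eq_add_one, rootE_simple]
    exact commutator_simple_left hi hlj hj
  | succ l hil ih =>
    rw [rootE_succ n hil, commutator_bracket (ih (by omega))
      (sub_eq_zero.2 (commute_simple_middle hi hil hlj hj).eq), bracket_zero_right, add_zero]
    have h1 : Commute (K n i) (rootE n l (l + 1)) :=
      commute_K_rootE (by omega) (by omega) (by omega) (by omega) (by omega) (by omega)
    have h2 : Kinv n l * rootE n l (l + 1) = v⁻¹ • (rootE n l (l + 1) * Kinv n l) :=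
      Kinv_left_rootE (by omega) (by omega) (by omega)
    rw [rootE_simple] at h1 h2
    rw [bracket_of_left (commutator_simple_left (by omega) hlj hj) h1 h2,
      neg_smul_mul_mul_mul_cancel v (K_mul_Kinv (by omega)) (commute_Kinv_Kinv (by omega) (by omega))
      (commute_K_Kinv (by omega) (by omega)).symm (commute_K_Kinv (by omega) (by omega)).symm]

theorem commute_middle (hi : 1 ≤ i) (hik : i < k) (hkl : k < l) (hlj : l < j) (hj : j ≤ n) :
    Commute (rootE n j i) (rootE n k l) :=
  commute_rootE hkl fun _ _ _ => commute_simple_middle hi (by omega) (by omega) hj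

theorem commute_middle_bar (hi : 1 ≤ i) (hik : i < k) (hkl : k < l) (hlj : l < j) (hj : j ≤ n) :
    Commute (rootE n j i) (rootEbar n k l) := by
  obtain ⟨l, rfl⟩ : ∃ l', l = l' + 1 := ⟨l - 1, by omega⟩
  exact commute_rootEbar (by omega)
    (fun _ _ _ => commute_simple_middle hi (by omega) (by omega) hj)
    (commute_bar_simple_middle hi (by omega) hlj hj)

theorem commutator_right (hi : 1 ≤ i) (hik : i < k) (hkj : k < j) (hj : j ≤ n) :
    rootE n j i * rootE n k j - rootE n k j * rootE n j i = rootE n k i * K n j * Kinv n k := by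
  induction j, hkj using Nat.le_induction with
  | base =>
    rw [Nat.succ_eq_add_one, rootE_simple]
    exact commutator_simple_right hi hik hj
  | succ j hkj ih =>
    rw [rootE_succ n hkj, commutator_bracket
      (sub_eq_zero.2 (commute_middle hi hik hkj (Nat.lt_succ_self j) hj).eq)
      (commutator_simple_right hi (by omega) hj), bracket_zero_left, zero_add,
      bracket_of_right (ih (by omega))
      (commute_K_rootE (by omega) hkj (by omega) (by omega) (by omega) (by omega))
      (Kinv_right_rootE (by omega) hkj (by omega)),
      mul_mul_mul_cancel (K_mul_Kinv (by omega)) (commute_Kinv_Kinv (by omega) (by omega))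
      (commute_K_Kinv (by omega) (by omega)).symm (commute_K_Kinv (by omega) (by omega)).symm]

/-- Splitting off E_j, both Leibniz terms contribute: one reduces to [F_j, E_j], the other to the
inductive commutator, and `cartan_step` adds them. -/
theorem commutator_opposite (hi : 1 ≤ i) (hij : i < j) (hj : j ≤ n) :
    rootE n j i * rootE n i j - rootE n i j * rootE n j i =
      -((v - v⁻¹)⁻¹ • (K n i * Kinv n j - Kinv n i * K n j)) := by
  induction j, hij using Nat.le_induction with
  | base =>
    rw [Nat.succ_eq_add_one, rootE_simple, rootE_neg_simple]
    exact F_mul_E (by omega)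
  | succ j hij ih =>
    have h1 : Commute (K n i) (rootE n j (j + 1)) :=
      commute_K_rootE (by omega) (by omega) (by omega) (by omega) (by omega) (by omega)
    have h2 : Kinv n j * rootE n j (j + 1) = v⁻¹ • (rootE n j (j + 1) * Kinv n j) :=
      Kinv_left_rootE (by omega) (by omega) (by omega)
    rw [rootE_simple] at h1 h2
    rw [rootE_succ n hij, commutator_bracket (commutator_left hi hij (Nat.lt_succ_self j) hj)
      (commutator_simple_right hi hij hj), rootE_neg_simple,
      bracket_of_left (F_mul_E (by omega)) h1 h2, bracket_of_right (ih (by omega))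
      (commute_K_rootE (by omega) hij (by omega) (by omega) (by omega) (by omega))
      (Kinv_right_rootE (by omega) hij (by omega))]
    exact cartan_step (K_mul_Kinv (by omega)) (commute_Kinv_Kinv (by omega) (by omega))
      (commute_K_Kinv (by omega) (by omega)).symm (commute_K_Kinv (by omega) (by omega)).symm
      (commute_K_K (by omega) (by omega)) (commute_K_Kinv (by omega) (by omega))

theorem commutator_lower (hk : 1 ≤ k) (hki : k < i) (hij : i < j) (hj : j ≤ n) :
    rootE n j i * rootE n k j - rootE n k j * rootE n j i =
      v⁻¹ • (rootE n k i * K n i * Kinv n j) := by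
  have h := commute_K_rootE (n := n) (m := j) hk hki (by omega) (by omega) (by omega) (by omega)
  rw [rootE_split hk hki hij hj, commutator_bracket
    (sub_eq_zero.2 (commute_neg_pos (by omega) hij hj hk hki (by omega) (by omega)).eq)
    (commutator_opposite (by omega) hij hj), bracket_zero_left, zero_add]
  exact cartan_bracket_pos_right (K_right_rootE hk hki (by omega))
    (Kinv_right_rootE hk hki (by omega)) h (commute_Kinv (by omega) h)

end Commutators

/-! ### Commutators of a negative root vector with odd positive root vectors -/

section OddCommutators

variable {n i j k l : ℕ}

/-- Cut at j: [E_{j,i}, E_{k,j}] contains K_j⁻¹, whose weight on Ē_{j,l} cancels the parameter of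
the bracket. -/
theorem commute_outer_bar (hk : 1 ≤ k) (hki : k < i) (hij : i < j) (hjl : j < l) (hl : l ≤ n) :
    Commute (rootE n j i) (rootEbar n k l) := by
  refine sub_eq_zero.1 ?_
  rw [rootEbar_split hk (hki.trans hij) hjl hl, commutator_bracket
    (commutator_lower hk hki hij (by omega))
    (sub_eq_zero.2 (commute_neg_posBar (by omega) hij (by omega) (by omega) hjl hl (by omega)).eq),
    bracket_zero_right, add_zero]
  have h : rootE n k i * K n i * Kinv n j * rootEbar n j l =
      v⁻¹ • (rootEbar n j l * (rootE n k i * K n i * Kinv n j)) :=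
    mul_skew_of_commute ((commute_pos_posBar hk hki hij hjl hl).mul_left
      (commute_K_rootEbar (by omega) hjl hl (by omega) (by omega) (by omega)))
      (Kinv_left_rootEbar (by omega) hjl hl)
  rw [smul_mul_assoc, h, mul_smul_comm, neg_add_cancel]

theorem commutator_bar_same_left (hi : 1 ≤ i) (hij : i < j) (hjl : j < l) (hl : l ≤ n) :
    rootE n j i * rootEbar n i l - rootEbar n i l * rootE n j i =
      -(rootEbar n j l * K n j * Kinv n i) := by
  rw [rootEbar_split hi hij hjl hl, commutator_bracket (commutator_opposite hi hij (by omega))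
    (sub_eq_zero.2 (commute_neg_posBar (by omega) hij (by omega) (by omega) hjl hl (by omega)).eq),
    bracket_zero_right, add_zero]
  have h := commute_K_rootEbar (m := i) (by omega) hjl hl (by omega) (by omega) (by omega)
  exact cartan_bracket_pos_left (K_left_rootEbar (by omega) hjl hl)
    (Kinv_left_rootEbar (by omega) hjl hl) h (commute_Kinv (by omega) h)
    (commute_K_Kinv (by omega) (by omega)).symm

theorem commutator_bar_cross (hi : 1 ≤ i) (hik : i < k) (hkj : k < j) (hjl : j < l)
    (hl : l ≤ n) :
    rootE n j i * rootEbar n k l - rootEbar n k l * rootE n j i =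
      -((v - v⁻¹) • (rootE n k i * rootEbar n j l * K n j * Kinv n k)) := by
  rw [rootEbar_split (by omega) hkj hjl hl, commutator_bracket
    (commutator_right hi hik hkj (by omega))
    (sub_eq_zero.2 (commute_neg_posBar (by omega) (by omega) (by omega) (by omega) hjl hl
      (by omega)).eq), bracket_zero_right, add_zero]
  exact cross_bracket
    (commute_neg_posBar hi hik (by omega) (by omega) hjl hl (by omega)).symm
    (K_left_rootEbar (by omega) hjl hl)
    (commute_Kinv (by omega)
      (commute_K_rootEbar (by omega) hjl hl (by omega) (by omega) (by omega)))

theorem commutator_bar_short (hi : 1 ≤ i) (hil : i < l) (hlj : l < j) (hj : j ≤ n) :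
    rootE n j i * rootEbar n i l - rootEbar n i l * rootE n j i =
      (v • (Kbar n l * rootE n j l) - rootE n j l * Kbar n l) * K n i := by
  obtain ⟨l, rfl⟩ : ∃ l', l = l' + 1 := ⟨l - 1, by omega⟩
  rcases (Nat.lt_succ_iff.1 hil).eq_or_lt with rfl | hil
  · rw [rootEbar_simple]
    exact commutator_bar_simple_left hi hlj hj
  · have h1 : Commute (K n i) (rootEbar n l (l + 1)) :=
      commute_K_rootEbar (by omega) (by omega) (by omega) (by omega) (by omega) (by omega)
    have h2 : Kinv n l * rootEbar n l (l + 1) = v⁻¹ • (rootEbar n l (l + 1) * Kinv n l) :=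
      Kinv_left_rootEbar (by omega) (by omega) (by omega)
    rw [rootEbar_simple] at h1 h2
    rw [rootEbar_succ n hil, commutator_bracket (commutator_left hi hil (by omega) hj)
      (sub_eq_zero.2 (commute_bar_simple_middle hi hil hlj hj).eq), bracket_zero_right, add_zero,
      -- The case of a simple root leaves K_l K_i K_l⁻¹ on the right, which collapses to K_i.
      bracket_of_left (commutator_bar_simple_left (by omega) hlj hj) h1 h2, mul_assoc,
      ← (commute_Kinv (n := n) (m := l) (by omega)
        (commute_K_K (j := i) (by omega) (by omega))).eq, ← mul_assoc, mul_assoc _ (K n l),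
      K_mul_Kinv (by omega), mul_one]

/-- Cut at i: the lower piece E_{k,i} commutes with E_{j,i}, and the upper piece Ē_{i,l} is covered
by `commutator_bar_short`. -/
theorem commutator_bar_overlap (hk : 1 ≤ k) (hki : k < i) (hil : i < l) (hlj : l < j)
    (hj : j ≤ n) :
    rootE n j i * rootEbar n k l - rootEbar n k l * rootE n j i =
      -((v - v⁻¹) • (Kbar n l * rootE n j l * rootE n k i * K n i))
        + (1 - v⁻¹ ^ 2) • (rootE n j l * Kbar n l * rootE n k i * K n i) := by
  rw [rootEbar_split hk hki hil (by omega), commutator_bracket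
    (sub_eq_zero.2 (commute_neg_pos (by omega) (by omega) hj hk hki (by omega) (by omega)).eq)
    (commutator_bar_short (by omega) hil hlj hj), bracket_zero_left, zero_add]
  exact Kbar_cross_bracket
    (commute_Kbar_rootE hk hki (by omega) (by omega) (by omega)).symm
    (commute_neg_pos (by omega) hlj hj hk hki (by omega) (by omega)).symm
    (K_right_rootE hk hki (by omega))

end OddCommutators

end QuantumQueer

/-! ### Assembly of the cases. -/

open QuantumQueer
theorem mainTheorem6 (n i j k l : ℕ)
    (hi : 1 ≤ i) (hij : i < j) (hj : j ≤ n) (hk : 1 ≤ k) (hkl : k < l) (hl : l ≤ n) :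
    ((j ≤ k ∨ (i < k ∧ l < j) ∨ l ≤ i ∨ (k < i ∧ j < l)) →
      rootE n j i * rootEbar n k l = rootEbar n k l * rootE n j i) ∧
    ((i = k ∧ j < l) →
      rootE n j i * rootEbar n k l = rootEbar n k l * rootE n j i
        - rootEbar n j l * K n j * Kinv n i) ∧
    ((i < k ∧ k < j ∧ j = l) →
      rootE n j i * rootEbar n k l = rootEbar n k l * rootE n j i
        + rootEbar n j i * rootE n k j * K n j ^ 2
        - rootE n k j * rootEbar n j i * K n j ^ 2
        - (v - v⁻¹) • (rootE n k i * Kbar n j * Kinv n k * K n j ^ 2)) ∧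
    ((i < k ∧ k < j ∧ j < l) →
      rootE n j i * rootEbar n k l = rootEbar n k l * rootE n j i
        - (v - v⁻¹) • (rootE n k i * rootEbar n j l * K n j * Kinv n k)) ∧
    ((i = k ∧ j = l) →
      rootE n j i * rootEbar n k l = rootEbar n k l * rootE n j i
        + (rootEbar n j i * rootE n i j - rootE n i j * rootEbar n j i) * K n j ^ 2
        - Kbar n j * Kinv n i * K n j ^ 2 + Kbar n j * K n i) ∧
    ((k = i ∧ l < j) →
      rootE n j i * rootEbar n k l = rootEbar n k l * rootE n j i
        + v • (Kbar n l * rootE n j l * K n i) - rootE n j l * Kbar n l * K n i) ∧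
    ((k < i ∧ i < l ∧ l < j) →
      rootE n j i * rootEbar n k l = rootEbar n k l * rootE n j i
        - (v - v⁻¹) • (Kbar n l * rootE n j l * rootE n k i * K n i)
        + (1 - v⁻¹ ^ 2) • (rootE n j l * Kbar n l * rootE n k i * K n i)) ∧
    ((k < i ∧ j = l) →
      rootE n j i * rootEbar n k l = rootEbar n k j * rootE n j i
        + rootEbar n j i * rootE n k j * K n j ^ 2
        - rootE n k j * rootEbar n j i * K n j ^ 2
        - (1 - v⁻¹ ^ 2) • (rootE n k i * K n i * Kbar n j)) := by
  have hKK (a b : ℕ) (ha : 1 ≤ a ∧ a ≤ n) (hb : 1 ≤ b ∧ b ≤ n) := commute_K_K (n := n) ha hb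
  have hKb (a b : ℕ) (ha : 1 ≤ a ∧ a ≤ n) (hb : 1 ≤ b ∧ b ≤ n) := commute_K_Kbar (n := n) ha hb
  refine ⟨?_, ?_, ?_, ?_, ?_, ?_, ?_, ?_⟩
  · rintro (h | ⟨h1, h2⟩ | h | ⟨h1, h2⟩)
    · exact commute_neg_posBar hi hij hj hk hkl hl (Or.inl h)
    · exact commute_middle_bar hi h1 hkl h2 hj
    · exact commute_neg_posBar hi hij hj hk hkl hl (Or.inr h)
    · exact commute_outer_bar hk h1 hij h2 hl
  · rintro ⟨rfl, h⟩
    rw [sub_eq_iff_eq_add'.1 (commutator_bar_same_left hi hij h hl), sub_eq_add_neg]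
  · rintro ⟨h1, h2, rfl⟩
    -- The even commutator here has the form a·l·k' with a = E_{k,i}, l = K_j and k' = K_k⁻¹, all of
    -- which commute with K̄_j.
    rw [mixed_commutator_rootE hi hij hk hkl hj, commutator_right hi h1 h2 hj,
      Kbar_commutator_lower
        (commute_Kbar_rootE_neg hi h1 (by omega) (by omega) (by omega))
        (hKb j j (by omega) (by omega)).symm
        (commute_Kinv (by omega) (hKb k j (by omega) (by omega))).symm
        (commute_K_rootE_neg hi h1 (by omega) (by omega) (by omega) (by omega))
        (commute_Kinv (by omega) (hKK k j (by omega) (by omega))), ← sub_eq_add_neg]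
  · rintro ⟨h1, h2, h3⟩
    rw [sub_eq_iff_eq_add'.1 (commutator_bar_cross hi h1 h2 h3 hl), ← sub_eq_add_neg]
  · rintro ⟨rfl, rfl⟩
    rw [mixed_commutator_rootE hi hij hi hij hj, commutator_opposite hi hij hj, cartan_Kbar
        (hKb i j (by omega) (by omega)).symm
        (commute_Kinv (by omega) (hKb i j (by omega) (by omega))).symm
        (hKb j j (by omega) (by omega)).symm
        (commute_Kinv (by omega) (hKb j j (by omega) (by omega))).symm
        (hKK j i (by omega) (by omega))
        (commute_Kinv (by omega) (hKK i j (by omega) (by omega))).symm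
        (K_mul_Kinv (by omega)), sub_mul]
    abel
  · rintro ⟨rfl, h⟩
    rw [sub_eq_iff_eq_add'.1 (commutator_bar_short hk hkl h hj), sub_mul, smul_mul_assoc,
      add_sub_assoc]
  · rintro ⟨h1, h2, h3⟩
    rw [sub_eq_iff_eq_add'.1 (commutator_bar_overlap hk h1 h2 h3 hj), ← add_assoc, ← sub_eq_add_neg]
  · rintro ⟨h, rfl⟩
    rw [mixed_commutator_rootE hi hij hk hkl hj, commutator_lower hk h hij hj,
      Kbar_commutator_upper
        (commute_Kbar_rootE hk h (by omega) (by omega) (by omega))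
        (hKb i j (by omega) (by omega)).symm
        (commute_Kinv (by omega) (hKb j j (by omega) (by omega))).symm
        (commute_K_rootE hk h (by omega) (by omega) (by omega) (by omega))
        (hKK j i (by omega) (by omega)) (hKb j j (by omega) (by omega)).symm
        (K_mul_Kinv (by omega)), ← sub_eq_add_neg]
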